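/- Let $F$ be a Frobenius group, i.e. a group acting faithfully and transitively on a finite set $X$ such that no non-trivial element of $F$ fixes more than one point of $X$ and some non-trivial element fixes a point. Let $N$ (the Frobenius kernel) be the set consisting of the identity and of all elements of $F$ that fix no point of $X$, and let $G'$ (the Frobenius complement) be the stabilizer in $F$ of a point of $X$. Then $N$ is a subgroup of $F$ and is a normal complement of $G'$ in $F$: $N$ is normal in $F$, $N\cap G'=1$ and $NG'=F$. Hence, if $\widetilde K/k$ is a Galois extension of fields with an isomorphism $\mathrm{Gal}(\widetilde K/k)\cong F$, and $K$ is the subfield of $\widetilde K$ fixed by (the subgroup corresponding to) $G'$, then $K/k$ is almost classically Galois. Here a finite separable extension $K/k$ with Galois closure $L$, $G=\mathrm{Gal}(L/k)$ and $H=\mathrm{Gal}(L/K)$, is called almost classically Galois if there is a regular (i.e. simply transitive) subgroup $M$ of $\mathrm{Sym}(G/H)$ that is normalized by $\lambda(G)$ and contained in $\lambda(G)$, where $\lambda\colon G\to \mathrm{Sym}(G/H)$ is the action of $G$ by left translation on the left cosets of $H$. -/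

import Mathlib

universe u v w z

/-- `F`, acting faithfully on `X` (so that it is a permutation group on `X`), is a Frobenius group:
`X` is finite, the action is transitive, no non-trivial element fixes more than one point, and some
non-trivial element fixes a point. -/
structure IsFrobeniusGroup (F : Type u) (X : Type v) [Group F] [MulAction F X] : Prop where
  finite : Finite X
  faithful : FaithfulSMul F X
  transitive : MulAction.IsPretransitive F X
  fixes_le_one : ∀ g : F, g ≠ 1 → ∀ x y : X, g • x = x → g • y = y → x = y
  exists_fixes : ∃ g : F, g ≠ 1 ∧ ∃ x : X, g • x = x

/-- The Frobenius kernel, as a set: the identity together with the elements that lie in no point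
stabilizer. -/
def frobeniusKernel (F : Type u) (X : Type v) [Group F] [MulAction F X] : Set F :=
  {g : F | g = 1 ∨ ∀ x : X, g ∉ MulAction.stabilizer F x}

/-- `N` is a normal complement of `H` in `G`: `N` is normal and every element of `G` is uniquely
a product of an element of `N` and an element of `H`. -/
def IsNormalComplement {G : Type u} [Group G] (N H : Subgroup G) : Prop :=
  N.Normal ∧ Subgroup.IsComplement' N H

/-- A group of permutations of `X` is regular if it is simply transitive on `X`. -/
def IsRegularPermGroup {X : Type u} (N : Subgroup (Equiv.Perm X)) : Prop :=
  ∀ x y : X, ∃! σ : Equiv.Perm X, σ ∈ N ∧ σ x = y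

/-- The Galois closure of a separable algebraic extension `K/k`. -/
abbrev GaloisClosure (k : Type u) (K : Type v) [Field k] [Field K] [Algebra k K] : Type v :=
  IntermediateField.normalClosure k K (AlgebraicClosure K)

/-- The subgroup `Gal(L/K)` of `Gal(L/k)`, for a tower of fields `L/K/k`. -/
def galSubgroup (k : Type u) (K : Type v) (L : Type w) [Field k] [Field K] [Field L]
    [Algebra k K] [Algebra k L] [Algebra K L] [IsScalarTower k K L] : Subgroup (L ≃ₐ[k] L) :=
  (IsScalarTower.toAlgHom k K L).fieldRange.fixingSubgroup

/-- A field extension `K/k` is almost classically Galois if it is finite and separable and, with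
`G = Gal(L/k)` and `G' = Gal(L/K)` for the Galois closure `L` of `K/k`, and with `lam` the action of
`G` by left translation on the left cosets `G ⧸ G'`, there is a regular subgroup `N` of
`Sym(G ⧸ G')` that is normalized by `lam(G)` and contained in `lam(G)`. -/
def IsAlmostClassicallyGalois (k : Type u) (K : Type v) [Field k] [Field K] [Algebra k K] : Prop :=
  FiniteDimensional k K ∧ Algebra.IsSeparable k K ∧
    let G := GaloisClosure k K ≃ₐ[k] GaloisClosure k K
    let G' : Subgroup G := galSubgroup k K (GaloisClosure k K)
    let lam : G →* Equiv.Perm (G ⧸ G') := MulAction.toPermHom G (G ⧸ G')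
    ∃ N : Subgroup (Equiv.Perm (G ⧸ G')),
      IsRegularPermGroup N ∧ lam.range ≤ Subgroup.normalizer (N : Set (Equiv.Perm (G ⧸ G'))) ∧ N ≤ lam.range

/-! Let `H` be a point stabilizer. A class function `f` on `H` extends to `F` by transporting it to
all stabilizers by conjugation and giving it the value `f 1` on fixed-point-free elements. For an
irreducible character `σ` of degree `d`, this extension is the virtual character `Ind σ + d·1 -
d·Ind 1`. It has norm one (`extend_mul_extend_inv`, `sum_extend`) and positive degree, so it is a
genuine character. By additivity every character of `H` extends. The extension of the regular
character is `|H|` on the Frobenius kernel and `0` elsewhere, so the kernel of a representation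
affording it is the Frobenius kernel, which is thus a normal subgroup. For the Galois statement, a
normal complement of `H` in `G` acts on `G ⧸ H` as a regular subgroup inside `λ(G)`. -/

open Module

/-! ### Traces -/

namespace LinearMap

variable {k A B C : Type*} [Field k] [AddCommGroup A] [Module k A] [AddCommGroup B] [Module k B]
  [AddCommGroup C] [Module k C] [FiniteDimensional k A] [FiniteDimensional k B]
  [FiniteDimensional k C]

/-- The trace is additive on short exact sequences. -/
theorem trace_eq_add_of_exact {i : A →ₗ[k] B} {p : B →ₗ[k] C} (hi : Function.Injective i)
    (hp : Function.Surjective p) (hip : range i = ker p) {fA : A →ₗ[k] A} {f : B →ₗ[k] B}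
    {fC : C →ₗ[k] C} (hA : f ∘ₗ i = i ∘ₗ fA) (hC : p ∘ₗ f = fC ∘ₗ p) :
    trace k B f = trace k A fA + trace k C fC := by
  obtain ⟨s, hs⟩ := p.exists_rightInverse_of_surjective (range_eq_top.2 hp)
  obtain ⟨r, hr⟩ := i.exists_leftInverse_of_injective (ker_eq_bot.2 hi)
  have hs' : ∀ c, p (s c) = c := fun c => LinearMap.congr_fun hs c
  have hr' : ∀ a, r (i a) = a := fun a => LinearMap.congr_fun hr a
  have hpi : ∀ a, p (i a) = 0 := fun a => by
    have : i a ∈ ker p := hip ▸ mem_range_self i a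
    exact this
  -- Corrects the retraction `r` so that it kills the image of `s`, which splits the sequence.
  let r' : B →ₗ[k] A := r ∘ₗ (LinearMap.id - s ∘ₗ p)
  have hid : i ∘ₗ r' + s ∘ₗ p = LinearMap.id := by
    ext b
    have hb : b - s (p b) ∈ range i := by
      rw [hip, mem_ker, map_sub, hs', sub_self]
    obtain ⟨a, ha⟩ := hb
    simp only [r', add_apply, comp_apply, sub_apply, id_apply, ← ha, hr']
    rw [ha, sub_add_cancel]
  have hr'i : r' ∘ₗ i = LinearMap.id := by
    ext a
    simp [r', hpi, hr']
  calc trace k B f = trace k B (f ∘ₗ (i ∘ₗ r' + s ∘ₗ p)) := by rw [hid, comp_id]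
    _ = trace k B ((f ∘ₗ i) ∘ₗ r') + trace k B ((f ∘ₗ s) ∘ₗ p) := by
        rw [comp_add, map_add, comp_assoc, comp_assoc]
    _ = trace k A (r' ∘ₗ (f ∘ₗ i)) + trace k C (p ∘ₗ (f ∘ₗ s)) := by
        rw [trace_comp_comm' (f ∘ₗ i) r', trace_comp_comm' (f ∘ₗ s) p]
    _ = trace k A fA + trace k C fC := by
        rw [hA, ← comp_assoc, hr'i, id_comp, ← comp_assoc, hC, comp_assoc, hs, comp_id]

/-- The trace of a linear map on `X → W` that permutes the coordinates. -/
theorem trace_pi_twist {X W : Type*} [Fintype X] [DecidableEq X] [AddCommGroup W] [Module k W]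
    [FiniteDimensional k W] (a : X → W →ₗ[k] W) (π : X → X) :
    trace k (X → W) (LinearMap.pi fun x => a x ∘ₗ (proj (π x) : (X → W) →ₗ[k] W)) =
      ∑ x with π x = x, trace k W (a x) := by
  have h : (LinearMap.pi fun x => a x ∘ₗ (proj (π x) : (X → W) →ₗ[k] W)) =
      ∑ x, (single k (fun _ : X => W) x ∘ₗ (a x ∘ₗ (proj (π x) : (X → W) →ₗ[k] W))) := by
    ext x w y
    simp [Finset.sum_apply, Pi.single_apply]
  rw [h, map_sum, Finset.sum_filter]
  refine Finset.sum_congr rfl fun x _ => ?_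
  rw [trace_comp_comm']
  split_ifs with hx
  · congr 1
    ext w
    simp [hx]
  · have : (a x ∘ₗ (proj (π x) : (X → W) →ₗ[k] W)) ∘ₗ single k (fun _ : X => W) x = 0 := by
      ext w
      simp [hx]
    rw [this, map_zero]

end LinearMap

/-! ### Virtual characters -/

namespace Representation

section Virtual

variable {G k : Type*} [Group G] [Field k]

theorem character_eq_ker_add_range {V W : Type*} [AddCommGroup V] [Module k V]
    [FiniteDimensional k V] [AddCommGroup W] [Module k W] [FiniteDimensional k W]
    {ρ : Representation k G V} {σ : Representation k G W} (f : IntertwiningMap ρ σ) (g : G) :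
    ρ.character g = f.ker.toRepresentation.character g + f.range.toRepresentation.character g := by
  refine LinearMap.trace_eq_add_of_exact (i := f.ker.toSubmodule.subtype)
    (p := f.toLinearMap.rangeRestrict) (Submodule.subtype_injective _)
    f.toLinearMap.surjective_rangeRestrict ?_ ?_ ?_
  · rw [Submodule.range_subtype, LinearMap.ker_rangeRestrict]
    rfl
  · rfl
  · ext v
    exact IntertwiningMap.isIntertwining _ _ f g v

theorem character_eq_sub_add_quotient {V : Type*} [AddCommGroup V] [Module k V]
    [FiniteDimensional k V] {ρ : Representation k G V} (S : Subrepresentation ρ) (g : G) :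
    ρ.character g = S.toRepresentation.character g +
      (ρ.quotient S.toSubmodule fun g _ hv => S.apply_mem_toSubmodule g hv).character g := by
  refine LinearMap.trace_eq_add_of_exact (i := S.toSubmodule.subtype)
    (p := S.toSubmodule.mkQ) (Submodule.subtype_injective _)
    S.toSubmodule.mkQ_surjective ?_ ?_ ?_
  · rw [Submodule.range_subtype, Submodule.ker_mkQ]
  · rfl
  · rfl

theorem character_prod {V W : Type*} [AddCommGroup V] [Module k V]
    [FiniteDimensional k V] [AddCommGroup W] [Module k W] [FiniteDimensional k W]
    (ρ : Representation k G V) (σ : Representation k G W) (g : G) :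
    (ρ.prod σ).character g = ρ.character g + σ.character g :=
  LinearMap.trace_prodMap' _ _

/-- A difference of two characters is the difference of the characters of two representations with
no non-zero map from the first to the second. -/
theorem exists_subsingleton_intertwiningMap {V : Type u} {W : Type v} [AddCommGroup V] [Module k V]
    [FiniteDimensional k V] [AddCommGroup W] [Module k W] [FiniteDimensional k W]
    (ρ : Representation k G V) (σ : Representation k G W) :
    ∃ (V' : Type u) (_ : AddCommGroup V') (_ : Module k V') (_ : FiniteDimensional k V')
      (W' : Type v) (_ : AddCommGroup W') (_ : Module k W') (_ : FiniteDimensional k W')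
      (ρ' : Representation k G V') (σ' : Representation k G W'),
      Subsingleton (IntertwiningMap ρ' σ') ∧
        ∀ g, ρ.character g - σ.character g = ρ'.character g - σ'.character g := by
  induction hn : finrank k V using Nat.strong_induction_on generalizing V W with
  | _ n ih =>
    by_cases h : Subsingleton (IntertwiningMap ρ σ)
    · exact ⟨V, _, _, inferInstance, W, _, _, inferInstance, ρ, σ, h, fun _ => rfl⟩
    · rw [not_subsingleton_iff_nontrivial] at h
      obtain ⟨f, hf⟩ := exists_ne (0 : IntertwiningMap ρ σ)
      have hlt : finrank k f.ker.toSubmodule < n := by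
        rw [← hn]
        refine Submodule.finrank_lt fun htop => hf ?_
        ext v
        have : v ∈ f.ker.toSubmodule := htop ▸ Submodule.mem_top
        exact this
      -- Passing to `ker f` and `W / range f` removes the character of `range f` from both sides.
      obtain ⟨V', i1, i2, i3, W', i4, i5, i6, ρ', σ', hs, hc⟩ :=
        ih _ hlt f.ker.toRepresentation (σ.quotient f.range.toSubmodule
          fun g _ hv => f.range.apply_mem_toSubmodule g hv) rfl
      refine ⟨V', i1, i2, i3, W', i4, i5, i6, ρ', σ', hs, fun g => ?_⟩
      rw [← hc g, character_eq_ker_add_range f g, character_eq_sub_add_quotient f.range g]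
      ring

theorem finrank_intertwiningMap_self_pos {V : Type*} [AddCommGroup V] [Module k V]
    [FiniteDimensional k V] (ρ : Representation k G V) (hV : 0 < finrank k V) :
    0 < finrank k (IntertwiningMap ρ ρ) := by
  have : Nontrivial V := finrank_pos_iff.1 hV
  obtain ⟨v, hv⟩ := exists_ne (0 : V)
  have : FiniteDimensional k (IntertwiningMap ρ ρ) :=
    FiniteDimensional.of_injective (IntertwiningMap.toLinearMapl (ρ := ρ) (σ := ρ))
      fun f g h => IntertwiningMap.ext h
  refine finrank_pos_iff_exists_ne_zero.2 ⟨IntertwiningMap.id ρ, fun h => hv ?_⟩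
  exact congrArg (fun f : IntertwiningMap ρ ρ => f v) h

/-- A difference of two characters that has norm one and positive degree is a character. -/
theorem exists_character_eq_sub_of_norm_one [Fintype G] [CharZero k] {V : Type u} {W : Type v}
    [AddCommGroup V] [Module k V] [FiniteDimensional k V] [AddCommGroup W] [Module k W]
    [FiniteDimensional k W] (ρ : Representation k G V) (σ : Representation k G W)
    (hdeg : finrank k W < finrank k V)
    (hnorm : ∑ g, (ρ.character g - σ.character g) * (ρ.character g⁻¹ - σ.character g⁻¹) =
      Nat.card G) :
    ∃ (V' : Type u) (_ : AddCommGroup V') (_ : Module k V') (_ : FiniteDimensional k V')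
      (τ : Representation k G V'), ∀ g, τ.character g = ρ.character g - σ.character g := by
  obtain ⟨A, i1, i2, i3, B, i4, i5, i6, α, β, hs, hc⟩ := exists_subsingleton_intertwiningMap ρ σ
  have hG : (Nat.card G : k) ≠ 0 := Nat.cast_ne_zero.2 Nat.card_pos.ne'
  let _ : Invertible (Nat.card G : k) := invertibleOfNonzero hG
  have hdeg' : finrank k B < finrank k A := by
    have h1 := hc 1
    simp only [char_one] at h1
    have h2 : ((finrank k V + finrank k B : ℕ) : k) = (finrank k A + finrank k W : ℕ) := by
      push_cast
      linear_combination h1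
    have := Nat.cast_injective h2
    omega
  have hab : ∑ g, β.character g * α.character g⁻¹ = 0 := by
    have := card_inv_mul_sum_char_mul_char_eq_finrank α β
    rw [finrank_zero_of_subsingleton, Nat.cast_zero] at this
    exact (mul_eq_zero.1 this).resolve_left (inv_ne_zero hG)
  have hba : ∑ g, α.character g * β.character g⁻¹ = 0 := by
    rw [← hab]
    refine Fintype.sum_equiv (Equiv.inv G) _ _ fun g => ?_
    simp [mul_comm]
  -- The cross terms vanish, so the norm is the sum of the two endomorphism dimensions. As `α` is
  -- nonzero, `β` must be zero.
  have hsum : (finrank k (IntertwiningMap α α) + finrank k (IntertwiningMap β β) : ℕ) = 1 := by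
    have h : ((finrank k (IntertwiningMap α α) + finrank k (IntertwiningMap β β) : ℕ) : k) =
        (1 : ℕ) := by
      rw [Nat.cast_add, ← card_inv_mul_sum_char_mul_char_eq_finrank,
        ← card_inv_mul_sum_char_mul_char_eq_finrank, Nat.cast_one, ← mul_add, inv_mul_eq_one₀ hG,
        ← hnorm]
      simp only [hc, sub_mul, mul_sub, Finset.sum_sub_distrib, hab, hba]
      ring
    exact Nat.cast_injective h
  have hA := finrank_intertwiningMap_self_pos α (by omega)
  have hB : finrank k B = 0 := by
    by_contra hB
    have := finrank_intertwiningMap_self_pos β (Nat.pos_of_ne_zero hB)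
    omega
  refine ⟨A, i1, i2, i3, α, fun g => ?_⟩
  have : Subsingleton B := finrank_zero_iff.1 hB
  have h0 : β g = 0 := Subsingleton.elim _ _
  rw [hc g, character, character, h0, map_zero, sub_zero]

end Virtual

end Representation

/-! ### The stabilizer cocycle of a section -/

namespace MulAction

variable {G X : Type*} [Group G] [MulAction G X] {x₀ : X} {t : X → G}

/-- For a section `t` of the orbit map of `x₀`, the element of the stabilizer of `x₀` through
which `g` carries `g⁻¹ • x` to `x`. -/
def stabilizerCocycle (ht : ∀ x, t x • x₀ = x) (g : G) (x : X) : stabilizer G x₀ :=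
  ⟨(t x)⁻¹ * g * t (g⁻¹ • x), by
    rw [mem_stabilizer_iff, mul_smul, mul_smul, ht, smul_inv_smul, inv_smul_eq_iff, ht]⟩

variable (ht : ∀ x, t x • x₀ = x)

@[simp]
theorem coe_stabilizerCocycle (g : G) (x : X) :
    (stabilizerCocycle ht g x : G) = (t x)⁻¹ * g * t (g⁻¹ • x) := rfl

theorem stabilizerCocycle_one (x : X) : stabilizerCocycle ht 1 x = 1 := by
  ext
  simp

theorem stabilizerCocycle_mul (g h : G) (x : X) : stabilizerCocycle ht (g * h) x =
    stabilizerCocycle ht g x * stabilizerCocycle ht h (g⁻¹ • x) := by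
  ext
  simp [mul_smul, mul_assoc]

theorem stabilizerCocycle_inv {g : G} {x : X} (hx : g • x = x) :
    stabilizerCocycle ht g⁻¹ x = (stabilizerCocycle ht g x)⁻¹ := by
  have hx' : g⁻¹ • x = x := by rw [inv_smul_eq_iff, hx]
  ext
  simp [hx, hx', mul_assoc]

theorem stabilizerCocycle_eq_one_iff {g : G} {x : X} (hx : g • x = x) :
    stabilizerCocycle ht g x = 1 ↔ g = 1 := by
  have hx' : g⁻¹ • x = x := by rw [inv_smul_eq_iff, hx]
  rw [Subtype.ext_iff, coe_stabilizerCocycle, hx', Subgroup.coe_one, mul_assoc, inv_mul_eq_one,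
    right_eq_mul]

end MulAction
-- Induction and extension of characters from a point stabilizer
namespace Frobenius

open MulAction Representation

variable {G : Type*} {X : Type v} [Group G] [MulAction G X] {x₀ : X} {t : X → G}
  (ht : ∀ x, t x • x₀ = x)

section Induced

variable {k : Type*} [Field k] {W : Type w} [AddCommGroup W] [Module k W]

/-- The representation of `G` induced from a representation of the stabilizer of `x₀`, realized
on functions on the orbit `X`. -/
def induced (σ : Representation k (stabilizer G x₀) W) : Representation k G (X → W) where
  toFun g := LinearMap.pi fun x =>
    σ (stabilizerCocycle ht g x) ∘ₗ (LinearMap.proj (g⁻¹ • x) : (X → W) →ₗ[k] W)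
  map_one' := by
    ext f x
    simp [stabilizerCocycle_one]
  map_mul' g h := by
    refine LinearMap.ext fun f => funext fun x => ?_
    simp [stabilizerCocycle_mul, mul_smul]

theorem character_induced [Fintype X] [DecidableEq X] [FiniteDimensional k W]
    (σ : Representation k (stabilizer G x₀) W) (g : G) :
    (induced ht σ).character g = ∑ x with g⁻¹ • x = x, σ.character (stabilizerCocycle ht g x) :=
  LinearMap.trace_pi_twist (fun x => σ (stabilizerCocycle ht g x)) fun x => g⁻¹ • x

end Induced

section Extension

variable [Fintype X] [DecidableEq X] {k : Type*} [Field k]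

/-- The class function on `G` extending a class function `f` of the stabilizer of `x₀` by the
constant `f 1` on the elements without fixed points. -/
def extend (f : stabilizer G x₀ → k) (g : G) : k :=
  f 1 + ∑ x with g⁻¹ • x = x, (f (stabilizerCocycle ht g x) - f 1)

theorem extend_add (f₁ f₂ : stabilizer G x₀ → k) (g : G) :
    extend ht (f₁ + f₂) g = extend ht f₁ g + extend ht f₂ g := by
  simp only [extend, Pi.add_apply, add_sub_add_comm, Finset.sum_add_distrib]
  ring

theorem extend_of_forall_ne (f : stabilizer G x₀ → k) {g : G} (hg : ∀ x : X, g • x ≠ x) :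
    extend ht f g = f 1 := by
  have : ∀ x : X, ¬ g⁻¹ • x = x := fun x hx => hg x (by rw [← eq_inv_smul_iff, hx])
  simp [extend, this]

theorem extend_one (f : stabilizer G x₀ → k) : extend ht f 1 = f 1 := by
  simp [extend, stabilizerCocycle_one]

variable (hfix : ∀ g : G, g ≠ 1 → ∀ x y : X, g • x = x → g • y = y → x = y)

-- A nontrivial element has at most one fixed point, so the sum has a single term and `f 1` cancels.
include hfix in
theorem extend_of_smul_eq (f : stabilizer G x₀ → k) {g : G} (hg : g ≠ 1) {x : X} (hx : g • x = x) :
    extend ht f g = f (stabilizerCocycle ht g x) := by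
  have : (Finset.univ.filter fun y : X => g⁻¹ • y = y) = {x} := by
    ext y
    simp only [Finset.mem_filter, Finset.mem_univ, true_and, Finset.mem_singleton,
      inv_smul_eq_iff]
    exact ⟨fun hy => hfix g hg y x hy.symm hx, fun hy => by rw [hy, hx]⟩
  rw [extend, this, Finset.sum_singleton, add_sub_cancel]

-- Turns the norm of an extension into the sum of an extension, which `sum_extend` evaluates.
include hfix in
theorem extend_mul_extend_inv (f : stabilizer G x₀ → k) (g : G) :
    extend ht f g * extend ht f g⁻¹ = extend ht (fun h => f h * f h⁻¹) g := by
  by_cases hg : g = 1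
  · simp [hg, extend_one]
  by_cases hx : ∃ x : X, g • x = x
  · obtain ⟨x, hx⟩ := hx
    have hx' : g⁻¹ • x = x := by rw [inv_smul_eq_iff, hx]
    rw [extend_of_smul_eq ht hfix _ hg hx, extend_of_smul_eq ht hfix _ hg hx,
      extend_of_smul_eq ht hfix _ (inv_ne_one.2 hg) hx', stabilizerCocycle_inv ht hx]
  · push Not at hx
    have hx' : ∀ x : X, g⁻¹ • x ≠ x := fun x h => hx x (by rw [← eq_inv_smul_iff, h])
    rw [extend_of_forall_ne ht _ hx, extend_of_forall_ne ht _ hx, extend_of_forall_ne ht _ hx',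
      inv_one]

omit [Fintype X] [DecidableEq X] in
include ht in
theorem card_mul_card_stabilizer : Nat.card X * Nat.card (stabilizer G x₀) = Nat.card G := by
  have : orbit G x₀ = Set.univ := Set.eq_univ_of_forall fun x => ⟨t x, ht x⟩
  rw [mul_comm, ← (stabilizer G x₀).card_mul_index, index_stabilizer, this, Set.ncard_univ]

/-- Conjugation by `t x` identifies the stabilizers of `x₀` and `x`, so each point contributes the
same sum. The `f 1` terms cancel because `|G| = |X||H|`. -/
theorem sum_extend [Fintype G] [Fintype (stabilizer G x₀)] (f : stabilizer G x₀ → k) :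
    ∑ g, extend ht f g = Nat.card X * ∑ h, f h := by
  have key : ∀ x : X, ∑ g with g⁻¹ • x = x, (f (stabilizerCocycle ht g x) - f 1) =
      ∑ h, (f h - f 1) := by
    intro x
    refine Finset.sum_bij' (fun g _ => stabilizerCocycle ht g x)
      (fun h _ => t x * h * (t x)⁻¹) (fun _ _ => Finset.mem_univ _) ?_ ?_ ?_ fun _ _ => rfl
    · intro h _
      have h1 : (h : G) • x₀ = x₀ := h.2
      have h2 : (t x)⁻¹ • x = x₀ := by rw [inv_smul_eq_iff, ht]
      rw [Finset.mem_filter, inv_smul_eq_iff, mul_smul, mul_smul, h2, h1, ht]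
      exact ⟨Finset.mem_univ _, rfl⟩
    · intro g hg
      simp [(Finset.mem_filter.1 hg).2, mul_assoc]
    · intro h _
      have h1 : (h : G)⁻¹ • x₀ = x₀ := (h⁻¹).2
      have h2 : (t x)⁻¹ • x = x₀ := by rw [inv_smul_eq_iff, ht]
      have h3 : (t x * (h : G) * (t x)⁻¹)⁻¹ • x = x := by
        simp only [mul_inv_rev, inv_inv, mul_smul, h2, h1, ht]
      ext
      rw [coe_stabilizerCocycle, h3]
      group
  have hG : (Nat.card G : k) = Nat.card X * Nat.card (stabilizer G x₀) := by
    rw [← card_mul_card_stabilizer ht, Nat.cast_mul]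
  simp only [extend, Finset.sum_add_distrib, Finset.sum_filter]
  rw [Finset.sum_comm]
  simp only [← Finset.sum_filter, key, Finset.sum_sub_distrib, Finset.sum_const, nsmul_eq_mul,
    Finset.card_univ, ← Nat.card_eq_fintype_card, hG]
  ring

variable [Finite G] [CharZero k]

include hfix in
theorem exists_character_eq_extend_of_isIrreducible [IsAlgClosed k] {W : Type w} [AddCommGroup W]
    [Module k W] [FiniteDimensional k W] (σ : Representation k (stabilizer G x₀) W)
    [IsIrreducible σ] :
    ∃ (V : Type (max v w)) (_ : AddCommGroup V) (_ : Module k V) (_ : FiniteDimensional k V)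
      (τ : Representation k G V), ∀ g, τ.character g = extend ht σ.character g := by
  have := Fintype.ofFinite G
  have := Fintype.ofFinite (stabilizer G x₀)
  -- Trivial representations on `W` itself supply the multiplicity `dim W`.
  have hdiff : ∀ g, ((induced ht σ).prod (Representation.trivial k G W)).character g -
      (induced ht (Representation.trivial k (stabilizer G x₀) W)).character g =
        extend ht σ.character g := by
    intro g
    have h1 : (Representation.trivial k G W).character g = finrank k W := LinearMap.trace_one k W
    have h2 : ∀ h, (Representation.trivial k (stabilizer G x₀) W).character h = finrank k W :=
      fun _ => LinearMap.trace_one k W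
    rw [character_prod, character_induced, character_induced, extend, char_one, h1,
      Finset.sum_sub_distrib]
    simp only [h2]
    ring
  have hW : 0 < finrank k W := by
    refine Nat.pos_of_ne_zero fun h => bot_ne_top (α := Subrepresentation σ) ?_
    have := finrank_zero_iff.1 h
    exact Subrepresentation.toSubmodule_injective (Subsingleton.elim _ _)
  have hH : (Nat.card (stabilizer G x₀) : k) ≠ 0 := Nat.cast_ne_zero.2 Nat.card_pos.ne'
  obtain ⟨V, i1, i2, i3, τ, hτ⟩ := exists_character_eq_sub_of_norm_one
    ((induced ht σ).prod (Representation.trivial k G W))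
    (induced ht (Representation.trivial k (stabilizer G x₀) W))
    (by rw [finrank_prod]; omega) (by
      let _ : Invertible (Nat.card (stabilizer G x₀) : k) := invertibleOfNonzero hH
      have h1 := card_inv_mul_sum_char_mul_char_eq_finrank σ σ
      rw [IsIrreducible.finrank_intertwiningMap_self, Nat.cast_one, inv_mul_eq_one₀ hH] at h1
      simp only [hdiff, extend_mul_extend_inv ht hfix, sum_extend, ← h1]
      rw [← card_mul_card_stabilizer ht, Nat.cast_mul])
  exact ⟨V, i1, i2, i3, τ, fun g => (hτ g).trans (hdiff g)⟩

include hfix in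
/-- Every character of a Frobenius complement extends to a character of the Frobenius group. -/
theorem exists_character_eq_extend [IsAlgClosed k] {W : Type w} [AddCommGroup W]
    [Module k W] [FiniteDimensional k W] (σ : Representation k (stabilizer G x₀) W) :
    ∃ (V : Type (max v w)) (_ : AddCommGroup V) (_ : Module k V) (_ : FiniteDimensional k V)
      (τ : Representation k G V), ∀ g, τ.character g = extend ht σ.character g := by
  induction hn : finrank k W using Nat.strong_induction_on generalizing W with
  | _ n ih =>
    by_cases hirr : IsIrreducible σ
    · exact exists_character_eq_extend_of_isIrreducible ht hfix σ
    -- The zero representation is not irreducible, yet has no proper nonzero subrepresentation to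
    -- split off.
    rcases subsingleton_or_nontrivial W with hW | hW
    · have h1 : ∀ h, σ.character h = 0 := fun h => by
        rw [character, Subsingleton.elim (σ h) 0, map_zero]
      refine ⟨X → W, inferInstance, inferInstance, inferInstance, induced ht σ, fun g => ?_⟩
      simp [character_induced, extend, h1]
    · have hne : Nontrivial (Subrepresentation σ) := ⟨⊥, ⊤, fun h =>
        bot_ne_top (α := Submodule k W) (congrArg Subrepresentation.toSubmodule h)⟩
      obtain ⟨S, hS⟩ : ∃ S : Subrepresentation σ, ¬ (S = ⊥ ∨ S = ⊤) := by
        by_contra! h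
        exact hirr ⟨h⟩
      push Not at hS
      have hlt : finrank k S.toSubmodule < finrank k W := Submodule.finrank_lt fun h =>
        hS.2 (Subrepresentation.toSubmodule_injective h)
      have hpos : 0 < finrank k S.toSubmodule := Nat.pos_of_ne_zero fun h =>
        hS.1 (Subrepresentation.toSubmodule_injective (Submodule.finrank_eq_zero.1 h))
      have hquot := S.toSubmodule.finrank_quotient_add_finrank
      obtain ⟨V₁, _, _, _, τ₁, h₁⟩ := ih _ (hn ▸ hlt) S.toRepresentation rfl
      obtain ⟨V₂, _, _, _, τ₂, h₂⟩ := ih _ (by omega) (σ.quotient S.toSubmodule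
        fun g _ hv => S.apply_mem_toSubmodule g hv) rfl
      refine ⟨V₁ × V₂, inferInstance, inferInstance, inferInstance, τ₁.prod τ₂, fun g => ?_⟩
      rw [character_prod, h₁, h₂, ← extend_add]
      congr 1
      ext h
      exact (character_eq_sub_add_quotient S h).symm

end Extension

end Frobenius

/-! ### Frobenius' theorem -/

namespace Frobenius

open MulAction Representation

/-- The regular representation of a group on its `k`-valued functions. -/
def regular (k H : Type*) [Field k] [Group H] : Representation k H (H → k) where
  toFun h := LinearMap.pi fun x => LinearMap.id ∘ₗ (LinearMap.proj (x * h) : (H → k) →ₗ[k] k)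
  map_one' := by
    refine LinearMap.ext fun f => funext fun x => ?_
    simp
  map_mul' g h := by
    refine LinearMap.ext fun f => funext fun x => ?_
    simp [mul_assoc]

theorem character_regular {k H : Type*} [Group H] [Fintype H] [DecidableEq H] [Field k] (h : H) :
    (regular k H).character h = if h = 1 then (Nat.card H : k) else 0 := by
  refine (LinearMap.trace_pi_twist (fun _ => LinearMap.id) fun x => x * h).trans ?_
  split_ifs with hh <;> simp [hh]

/-- An element on whose powers the character of a representation is constant acts trivially. -/
theorem apply_eq_one_of_character_zpowers {G k V : Type*} [Group G] [Finite G] [Field k]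
    [CharZero k] [AddCommGroup V] [Module k V] [FiniteDimensional k V]
    (τ : Representation k G V) {g : G}
    (hg : ∀ γ ∈ Subgroup.zpowers g, τ.character γ = finrank k V) : τ g = 1 := by
  have := Fintype.ofFinite (Subgroup.zpowers g)
  have hC : (Nat.card (Subgroup.zpowers g) : k) ≠ 0 := Nat.cast_ne_zero.2 Nat.card_pos.ne'
  let _ : Invertible (Nat.card (Subgroup.zpowers g) : k) := invertibleOfNonzero hC
  let τ' : Representation k (Subgroup.zpowers g) V := τ.comp (Subgroup.zpowers g).subtype
  -- The mean of the character over the cyclic group is the dimension of its invariants, here that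
  -- of all of `V`.
  have h1 := card_inv_mul_sum_char_eq_finrank τ'
  have h2 : ∀ γ, τ'.character γ = finrank k V := fun γ => hg γ γ.2
  simp only [h2, Finset.sum_const, Finset.card_univ, nsmul_eq_mul, ← Nat.card_eq_fintype_card]
    at h1
  rw [inv_mul_cancel_left₀ hC, Nat.cast_inj] at h1
  have h3 := Submodule.eq_top_of_finrank_eq h1.symm
  ext v
  have hv : v ∈ invariants τ' := h3 ▸ Submodule.mem_top
  exact hv ⟨g, Subgroup.mem_zpowers g⟩

section

variable {F : Type u} {X : Type v} [Group F] [MulAction F X]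

/-- If a nontrivial power of `g` fixes `x`, it also fixes `g • x`, since it commutes with `g`; hence
`g` fixes `x`. -/
theorem zpowers_subset_frobeniusKernel
    (hfix : ∀ g : F, g ≠ 1 → ∀ x y : X, g • x = x → g • y = y → x = y) {g γ : F}
    (hg : g ∈ frobeniusKernel F X) (hγ : γ ∈ Subgroup.zpowers g) : γ ∈ frobeniusKernel F X := by
  rcases hg with rfl | hg
  · left
    simpa using hγ
  · refine or_iff_not_imp_left.2 fun h1 x hx => hg x ?_
    obtain ⟨n, rfl⟩ := hγ
    have hx : g ^ n • x = x := hx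
    refine hfix _ h1 _ _ ?_ hx
    change g ^ n • g • x = g • x
    rw [← mul_smul, ← (Commute.self_zpow g n).eq, mul_smul, hx]

/-- **Frobenius' theorem**: the Frobenius kernel is a normal subgroup. -/
theorem exists_normal_coe_eq_frobeniusKernel (hF : IsFrobeniusGroup F X) :
    ∃ N : Subgroup F, N.Normal ∧ (N : Set F) = frobeniusKernel F X ∧
      Nat.card N = Nat.card X := by
  classical
  obtain ⟨hX, hfaith, htrans, hfix, g₀, -, x₀, -⟩ := hF
  have : Finite F := Finite.of_injective _ (toPerm_injective (α := F) (β := X))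
  have := Fintype.ofFinite F
  have := Fintype.ofFinite X
  have := Fintype.ofFinite (stabilizer F x₀)
  choose t ht using fun x => exists_smul_eq F x₀ x
  -- With `c = |H|` this is the regular character; with `c = 1` its extension is the indicator of
  -- the Frobenius kernel, whose sum gives `|N| = |X|`.
  let f : ℂ → stabilizer F x₀ → ℂ := fun c h => if h = 1 then c else 0
  have hmem : ∀ c g, g ∈ frobeniusKernel F X → extend ht (f c) g = c := by
    rintro c g (rfl | hg)
    · simp [extend_one, f]
    · simp [extend_of_forall_ne ht (f c) hg, f]
  have hnmem : ∀ c g, g ∉ frobeniusKernel F X → extend ht (f c) g = 0 := by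
    intro c g hg
    obtain ⟨hg, x, hx⟩ : g ≠ 1 ∧ ∃ x : X, g • x = x := by
      simpa [frobeniusKernel] using hg
    have : stabilizerCocycle ht g x ≠ 1 := (stabilizerCocycle_eq_one_iff ht hx).not.2 hg
    simp [extend_of_smul_eq ht hfix (f c) hg hx, f, this]
  have hone : (1 : F) ∈ frobeniusKernel F X := Or.inl rfl
  obtain ⟨V, _, _, _, τ, hτ⟩ := exists_character_eq_extend ht hfix (regular ℂ (stabilizer F x₀))
  have hτ' : ∀ g, τ.character g = extend ht (f (Nat.card (stabilizer F x₀))) g := by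
    intro g
    rw [hτ]
    congr 1
    ext h
    exact character_regular h
  have hdim : (finrank ℂ V : ℂ) = Nat.card (stabilizer F x₀) := by
    rw [← char_one τ, hτ', hmem _ _ hone]
  have hker : (τ.ker : Set F) = frobeniusKernel F X := by
    ext g
    refine ⟨fun hg => ?_, fun hg => ?_⟩
    · by_contra hg'
      have h1 : τ g = 1 := hg
      have h2 : τ.character g = finrank ℂ V := by
        rw [character, h1]
        exact LinearMap.trace_one ℂ V
      rw [hτ', hnmem _ _ hg', hdim] at h2
      exact Nat.cast_ne_zero.2 Nat.card_pos.ne' h2.symm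
    · refine apply_eq_one_of_character_zpowers τ fun γ hγ => ?_
      rw [hτ', hmem _ _ (zpowers_subset_frobeniusKernel hfix hg hγ), hdim]
  refine ⟨τ.ker, inferInstance, hker, ?_⟩
  have hsum := sum_extend ht (f 1)
  have hite : ∀ g, extend ht (f 1) g = if g ∈ τ.ker then 1 else 0 := by
    intro g
    have hiff : g ∈ τ.ker ↔ g ∈ frobeniusKernel F X := by rw [← hker]; rfl
    split_ifs with hg
    · exact hmem _ _ (hiff.1 hg)
    · exact hnmem _ _ (hiff.not.1 hg)
  have hf : ∑ h, f 1 h = 1 := by simp [f]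
  rw [hf, mul_one, Finset.sum_congr rfl fun g _ => hite g, Finset.sum_boole, Nat.cast_inj] at hsum
  rw [← hsum, Nat.card_eq_fintype_card, Fintype.card_subtype]

theorem exists_isNormalComplement (hF : IsFrobeniusGroup F X) :
    ∃ N : Subgroup F, (N : Set F) = frobeniusKernel F X ∧
      ∀ x : X, IsNormalComplement N (stabilizer F x) := by
  obtain ⟨N, hN, hker, hcard⟩ := exists_normal_coe_eq_frobeniusKernel hF
  obtain ⟨hX, hfaith, htrans, -, -⟩ := hF
  have : Finite F := Finite.of_injective _ (toPerm_injective (α := F) (β := X))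
  refine ⟨N, hker, fun x => ⟨hN, Subgroup.isComplement'_of_card_mul_and_disjoint ?_ ?_⟩⟩
  · rw [hcard, ← index_stabilizer_of_transitive F x, mul_comm, Subgroup.card_mul_index]
  · refine Subgroup.disjoint_def.2 fun {g} hg hx => ?_
    have hg : g ∈ frobeniusKernel F X := hker ▸ hg
    exact hg.resolve_right fun h => h x hx

end

end Frobenius

/-! ### Normal complements and Galois closures -/

section AlmostClassicallyGalois

theorem IsNormalComplement.exists_isRegularPermGroup {G : Type*} [Group G] {N H : Subgroup G}
    (h : IsNormalComplement N H) :
    ∃ M : Subgroup (Equiv.Perm (G ⧸ H)), IsRegularPermGroup M ∧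
      (MulAction.toPermHom G (G ⧸ H)).range ≤ Subgroup.normalizer (M : Set (Equiv.Perm (G ⧸ H))) ∧
        M ≤ (MulAction.toPermHom G (G ⧸ H)).range := by
  obtain ⟨hN, hc⟩ := h
  refine ⟨N.map (MulAction.toPermHom G (G ⧸ H)), fun x y => ?_, ?_, Subgroup.map_le_range _ _⟩
  · induction x using QuotientGroup.induction_on with | _ a
    induction y using QuotientGroup.induction_on with | _ b
    obtain ⟨⟨⟨m, hm⟩, ⟨h, hh⟩⟩, hmh : m * h = a⁻¹ * b⟩ := hc.2 (a⁻¹ * b)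
    have hb : ((a * m * a⁻¹ * a : G) : G ⧸ H) = b := by
      rw [QuotientGroup.eq]
      have : (a * m * a⁻¹ * a)⁻¹ * b = h := by
        rw [show b = a * (m * h) by rw [hmh]; group]
        group
      rwa [this]
    -- Since `a⁻¹ * b = m * h`, this conjugate of `m` carries `aH` to `bH`. Uniqueness follows from
    -- `N ∩ H = 1`.
    refine ⟨MulAction.toPermHom G (G ⧸ H) (a * m * a⁻¹),
      ⟨Subgroup.mem_map_of_mem _ (hN.conj_mem m hm a), hb⟩, ?_⟩
    rintro _ ⟨⟨n, hn, rfl⟩, hnb : ((n * a : G) : G ⧸ H) = b⟩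
    congr 1
    rw [← hb, QuotientGroup.eq] at hnb
    have hmem : (n * a)⁻¹ * (a * m * a⁻¹ * a) ∈ N := by
      have := hN.conj_mem _ (N.mul_mem (N.inv_mem hn) (hN.conj_mem m hm a)) a⁻¹
      convert this using 1
      group
    have := Subgroup.disjoint_def.1 hc.disjoint hmem hnb
    rw [inv_mul_eq_one] at this
    exact mul_right_cancel this
  · rw [MonoidHom.range_eq_map, ← Subgroup.normalizer_eq_top N, Subgroup.coe_map]
    exact Subgroup.le_normalizer_map _

/-- Serves to descend from `Gal(L/k)` to the Galois group of the closure of `K/k`, without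
identifying `L` with that closure. -/
theorem IsNormalComplement.map {Γ G : Type*} [Group Γ] [Group G] {N : Subgroup Γ} {H : Subgroup G}
    (π : Γ →* G) (hπ : Function.Surjective π) (h : IsNormalComplement N (H.comap π)) :
    IsNormalComplement (N.map π) H := by
  obtain ⟨hN, hc⟩ := h
  refine ⟨hN.map π hπ, Subgroup.isComplement'_of_disjoint_and_mul_eq_univ ?_ ?_⟩
  · rw [Subgroup.disjoint_def]
    rintro _ ⟨n, hn, rfl⟩ hH
    rw [Subgroup.disjoint_def.1 hc.disjoint hn hH, map_one]
  · refine Set.eq_univ_of_forall fun g => ?_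
    obtain ⟨γ, rfl⟩ := hπ g
    obtain ⟨⟨⟨n, hn⟩, ⟨h, hh⟩⟩, hnh : n * h = γ⟩ := hc.2 γ
    exact ⟨π n, ⟨n, hn, rfl⟩, π h, hh, by rw [← hnh, map_mul]⟩

theorem IsNormalComplement.comap_mulEquiv {Γ G : Type*} [Group Γ] [Group G] {N H : Subgroup G}
    (e : Γ ≃* G) (h : IsNormalComplement N H) :
    IsNormalComplement (N.comap e.toMonoidHom) (H.comap e.toMonoidHom) := by
  have key : ∀ S : Subgroup G, S.comap e.toMonoidHom = S.map e.symm.toMonoidHom := fun S =>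
    Subgroup.comap_equiv_eq_map_symm' e S
  rw [key N]
  refine IsNormalComplement.map e.symm.toMonoidHom e.symm.surjective ?_
  rw [Subgroup.comap_comap]
  convert h
  ext g
  simp

theorem comap_restrictNormalHom_galSubgroup {k K M L : Type*} [Field k] [Field K] [Field M]
    [Field L] [Algebra k K] [Algebra k M] [Algebra k L] [Algebra K M] [Algebra K L] [Algebra M L]
    [IsScalarTower k K M] [IsScalarTower k K L] [IsScalarTower k M L] [IsScalarTower K M L]
    [Normal k M] :
    (galSubgroup k K M).comap (AlgEquiv.restrictNormalHom (K₁ := L) M) = galSubgroup k K L := by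
  ext χ
  rw [Subgroup.mem_comap, galSubgroup, galSubgroup, IntermediateField.mem_fixingSubgroup_iff,
    IntermediateField.mem_fixingSubgroup_iff]
  have key : ∀ x : K, AlgEquiv.restrictNormalHom M χ (algebraMap K M x) = algebraMap K M x ↔
      χ (algebraMap K L x) = algebraMap K L x := fun x => by
    rw [← (algebraMap M L).injective.eq_iff, IsScalarTower.algebraMap_apply K M L,
      ← AlgEquiv.restrictNormal_commutes χ M]
    rfl
  constructor
  · rintro h _ ⟨x, rfl⟩
    exact (key x).1 (h _ ⟨x, rfl⟩)
  · rintro h _ ⟨x, rfl⟩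
    exact (key x).2 (h _ ⟨x, rfl⟩)

/-- A normal closure of a subextension `K` of a normal extension `L` embeds into `L` over `K`. -/
theorem nonempty_algHom_of_isNormalClosure {k K M L : Type*} [Field k] [Field K] [Field M]
    [Field L] [Algebra k K] [Algebra k M] [Algebra k L] [Algebra K M] [Algebra K L]
    [IsScalarTower k K M] [IsScalarTower k K L] [Normal k L] [h : IsNormalClosure k K M] :
    Nonempty (M →ₐ[K] L) := by
  let j : M →ₐ[k] L := h.lift fun x => by
    rw [← minpoly.algebraMap_eq (algebraMap K L).injective]
    exact Normal.splits inferInstance _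
  -- The embedding `j` may move `K`. An automorphism `σ` of `L` agreeing with `j` on `K` corrects
  -- this: `σ⁻¹ ∘ j` is `K`-linear.
  let σ : L →ₐ[k] L := (j.comp (IsScalarTower.toAlgHom k K M)).liftNormal L
  have hσ : ∀ x : K, σ (algebraMap K L x) = j (algebraMap K M x) := fun x =>
    (j.comp (IsScalarTower.toAlgHom k K M)).liftNormal_commutes L x
  let e : L ≃ₐ[k] L := AlgEquiv.ofBijective σ (Algebra.IsAlgebraic.algHom_bijective σ)
  exact ⟨{ (e.symm.toAlgHom.comp j).toRingHom with
    commutes' := fun x => e.symm_apply_eq.2 (hσ x).symm }⟩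

theorem isAlmostClassicallyGalois_of_isNormalComplement {k : Type w} {L : Type z} [Field k]
    [Field L] [Algebra k L] [IsGalois k L] [FiniteDimensional k L]
    (K : IntermediateField k L) {N : Subgroup (L ≃ₐ[k] L)}
    (h : IsNormalComplement N K.fixingSubgroup) : IsAlmostClassicallyGalois k K := by
  refine ⟨inferInstance, inferInstance, ?_⟩
  have hNC : IsNormalClosure k K (GaloisClosure k K) := inferInstance
  have : Normal k (GaloisClosure k K) := hNC.normal
  obtain ⟨j⟩ := nonempty_algHom_of_isNormalClosure (k := k) (K := K) (M := GaloisClosure k K)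
    (L := L)
  let _ : Algebra (GaloisClosure k K) L := j.toRingHom.toAlgebra
  have : IsScalarTower K (GaloisClosure k K) L :=
    IsScalarTower.of_algebraMap_eq fun x => (j.commutes x).symm
  have : IsScalarTower k (GaloisClosure k K) L :=
    IsScalarTower.of_algebraMap_eq fun x => ((j.restrictScalars k).commutes x).symm
  have hK : galSubgroup k K L = K.fixingSubgroup :=
    congrArg IntermediateField.fixingSubgroup K.fieldRange_val
  rw [← hK, ← comap_restrictNormalHom_galSubgroup (M := GaloisClosure k K)] at h
  exact (h.map _ (AlgEquiv.restrictNormalHom_surjective L)).exists_isRegularPermGroup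

end AlmostClassicallyGalois

theorem mainTheorem3 {F : Type u} {X : Type v} [Group F] [MulAction F X]
    (hF : IsFrobeniusGroup F X) :
    (∃ N : Subgroup F, (N : Set F) = frobeniusKernel F X ∧
      ∀ x : X, IsNormalComplement N (MulAction.stabilizer F x)) ∧
    ∀ (k : Type w) (L : Type z) [Field k] [Field L] [Algebra k L] [IsGalois k L]
      (e : (L ≃ₐ[k] L) ≃* F) (x : X) (K : IntermediateField k L),
      K = IntermediateField.fixedField ((MulAction.stabilizer F x).comap e.toMonoidHom) →
        IsAlmostClassicallyGalois k K := by
  refine ⟨Frobenius.exists_isNormalComplement hF, ?_⟩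
  rintro k L _ _ _ _ e x K rfl
  obtain ⟨N, -, hN⟩ := Frobenius.exists_isNormalComplement hF
  obtain ⟨hX, hfaith, -, -, -⟩ := hF
  have : Finite F := Finite.of_injective _ (MulAction.toPerm_injective (α := F) (β := X))
  have : Finite (L ≃ₐ[k] L) := Finite.of_equiv F e.symm.toEquiv
  have : FiniteDimensional k L := IsGalois.finiteDimensional_of_finite k L
  refine isAlmostClassicallyGalois_of_isNormalComplement _
    (N := N.comap e.toMonoidHom) ?_
  rw [IntermediateField.fixingSubgroup_fixedField]
  exact (hN x).comap_mulEquiv e
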